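/- **Setting.** Let $n,d$ be dimensions, and let $\mathcal K_{bcs}(\mathbb R^d)$ be the collection of nonempty, closed, bounded, convex sets $K\subset\mathbb R^d$ that are symmetric ($-K=K$). For $K\subset\mathbb R^d$ put $|K|=\sup_{v\in K}|v|$. A set-valued map $F$ on $\mathbb R^n$ is measurable if $\{x: F(x)\cap U\neq\emptyset\}$ is Lebesgue measurable for every open $U\subset\mathbb R^d$, and locally integrably bounded if it is measurable and, for some non-negative $k\in L^1_{loc}(\mathbb R^n)$, $F(x)\subset B(0,k(x))$ for a.e. $x$. For $0<p\le\infty$, $L^p_{\mathcal K}(\mathbb R^n,|\cdot|)$ is the set of measurable maps $F$ with values in $\mathcal K_{bcs}(\mathbb R^d)$ almost everywhere such that $\|F\|_{L^p_{\mathcal K}}:=\big\|\,|F(\cdot)|\,\big\|_{L^p(\mathbb R^n)}<\infty$; for $0<p<\infty$, $L^{p,\infty}_{\mathcal K}(\mathbb R^n,|\cdot|)$ is defined in the same way with $\|F\|_{L^{p,\infty}_{\mathcal K}}:=\sup_{\lambda>0}\lambda\,|\{x:|F(x)|>\lambda\}|^{1/p}<\infty$. The Aumann integral is $$\int_Q F\,dy=\Big\{\int_Q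 f\,dy : f\in L^1(Q,\mathbb R^d),\ f(y)\in F(y)\text{ for a.e. }y\in Q\Big\}.$$ For $0<\alpha<1$ and locally integrably bounded $F$, the fractional maximal operator is $$M_\alpha F(x)=\overline{\mathrm{conv}}\Big(\bigcup_Q \chi_Q(x)\,\frac{1}{|Q|^{1-\alpha}}\int_Q F(y)\,dy\Big),$$ the union being over all cubes $Q\subset\mathbb R^n$ (of positive side length) with sides parallel to the coordinate axes. **Theorem.** Let $0<\alpha<1$. (1) If $1<p<q\le\infty$ and $1/p-1/q=\alpha$, then $M_\alpha$ is bounded from $L^p_{\mathcal K}(\mathbb R^n,|\cdot|)$ to $L^q_{\mathcal K}(\mathbb R^n,|\cdot|)$: there is a constant $C<\infty$ such that every $F\in L^p_{\mathcal K}(\mathbb R^n,|\cdot|)$ is locally integrably bounded, $M_\alpha F\in L^q_{\mathcal K}(\mathbb R^n,|\cdot|)$, and $\|M_\alpha F\|_{L^q_{\mathcal K}}\le C\|F\|_{L^p_{\mathcal K}}$. (2) $M_\alpha$ is bounded from $L^1_{\mathcal K}(\mathbb R^n,|\cdot|)$ to $L^{1/(1-\alpha),\infty}_{\mathcal K}(\mathbb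 R^n,|\cdot|)$: there is a constant $C<\infty$ such that every $F\in L^1_{\mathcal K}(\mathbb R^n,|\cdot|)$ is locally integrably bounded, $M_\alpha F\in L^{1/(1-\alpha),\infty}_{\mathcal K}(\mathbb R^n,|\cdot|)$, and $\|M_\alpha F\|_{L^{1/(1-\alpha),\infty}_{\mathcal K}}\le C\|F\|_{L^1_{\mathcal K}}$. -/

import Mathlib

open MeasureTheory Set
open scoped ENNReal NNReal Pointwise

noncomputable section

namespace ConvexSetValued

/-- The class `𝒦_bcs(ℝ^d)` of nonempty, closed, bounded, convex, symmetric subsets of `ℝ^d`. -/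
structure IsKbcs {d : ℕ} (K : Set (EuclideanSpace ℝ (Fin d))) : Prop where
  nonempty : K.Nonempty
  isClosed : IsClosed K
  isBounded : Bornology.IsBounded K
  convex : Convex ℝ K
  symmetric : -K = K

/-- `|K| = sup_{v ∈ K} |v|`, as an extended nonnegative number. -/
def setNorm {d : ℕ} (K : Set (EuclideanSpace ℝ (Fin d))) : ℝ≥0∞ :=
  ⨆ v ∈ K, ‖v‖ₑ

/-- Measurability of a set-valued map on `ℝ^n` with respect to the (complete) Lebesgue
`σ`-algebra: for every open `U`, the set `{x : F x ∩ U ≠ ∅}` is Lebesgue measurable. -/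
def SetMeasurable {n d : ℕ}
    (F : EuclideanSpace ℝ (Fin n) → Set (EuclideanSpace ℝ (Fin d))) : Prop :=
  ∀ U : Set (EuclideanSpace ℝ (Fin d)), IsOpen U →
    NullMeasurableSet {x | (F x ∩ U).Nonempty} volume

/-- `F` is measurable and `F x ⊆ B(0, k x)` for a.e. `x`, for some nonnegative
`k ∈ L¹_loc(ℝ^n)`. -/
def LocallyIntegrablyBounded {n d : ℕ}
    (F : EuclideanSpace ℝ (Fin n) → Set (EuclideanSpace ℝ (Fin d))) : Prop :=
  SetMeasurable F ∧
    ∃ k : EuclideanSpace ℝ (Fin n) → ℝ, (∀ x, 0 ≤ k x) ∧ LocallyIntegrable k volume ∧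
      ∀ᵐ x, F x ⊆ Metric.ball 0 (k x)

/-- The Aumann integral of `F` over `Q`: the set of integrals over `Q` of the integrable
selections of `F` on `Q`. -/
def aumannIntegral {n d : ℕ} (Q : Set (EuclideanSpace ℝ (Fin n)))
    (F : EuclideanSpace ℝ (Fin n) → Set (EuclideanSpace ℝ (Fin d))) :
    Set (EuclideanSpace ℝ (Fin d)) :=
  {v | ∃ f : EuclideanSpace ℝ (Fin n) → EuclideanSpace ℝ (Fin d),
    IntegrableOn f Q volume ∧ (∀ᵐ x ∂(volume.restrict Q), f x ∈ F x) ∧ ∫ x in Q, f x = v}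

/-- Cubes (of positive side length) with sides parallel to the coordinate axes; as for dyadic
cubes, they are taken half-open. -/
def IsCube {n : ℕ} (Q : Set (EuclideanSpace ℝ (Fin n))) : Prop :=
  ∃ (a : EuclideanSpace ℝ (Fin n)) (l : ℝ), 0 < l ∧
    Q = {x | ∀ i, a i ≤ x i ∧ x i < a i + l}

/-- The fractional average `A_{Q,α} F(x) = χ_Q(x) |Q|^{-(1-α)} ∫_Q F`. -/
def fractionalAverage {n d : ℕ} (Q : Set (EuclideanSpace ℝ (Fin n))) (α : ℝ)
    (F : EuclideanSpace ℝ (Fin n) → Set (EuclideanSpace ℝ (Fin d)))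
    (x : EuclideanSpace ℝ (Fin n)) : Set (EuclideanSpace ℝ (Fin d)) :=
  Q.indicator (fun _ => (1 : ℝ)) x •
    ((1 / (volume.real Q) ^ (1 - α)) • aumannIntegral Q F)

/-- The fractional maximal operator: the closed convex hull of `⋃_Q A_{Q,α} F(x)`, the union
being over all cubes with sides parallel to the axes. -/
def fractionalMaximal {n d : ℕ} (α : ℝ)
    (F : EuclideanSpace ℝ (Fin n) → Set (EuclideanSpace ℝ (Fin d)))
    (x : EuclideanSpace ℝ (Fin n)) : Set (EuclideanSpace ℝ (Fin d)) :=
  closure (convexHull ℝ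
    (⋃ (Q : Set (EuclideanSpace ℝ (Fin n))) (_ : IsCube Q), fractionalAverage Q α F x))

/-- The norm of `L^p_𝒦(ℝ^n, |·|)`, the `L^p` norm of `x ↦ |F x|`
(the essential supremum for `p = ∞`). -/
def normLK {n d : ℕ} (p : ℝ≥0∞)
    (F : EuclideanSpace ℝ (Fin n) → Set (EuclideanSpace ℝ (Fin d))) : ℝ≥0∞ :=
  eLpNorm (fun x => setNorm (F x)) p volume

/-- The quasi-norm of `L^{p,∞}_𝒦(ℝ^n, |·|)`: `sup_{t > 0} t |{x : |F x| > t}|^{1/p}`. -/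
def normWeakLK {n d : ℕ} (p : ℝ)
    (F : EuclideanSpace ℝ (Fin n) → Set (EuclideanSpace ℝ (Fin d))) : ℝ≥0∞ :=
  ⨆ (t : ℝ≥0) (_ : 0 < t), (t : ℝ≥0∞) * volume {x | (t : ℝ≥0∞) < setNorm (F x)} ^ (1 / p)

/-- Membership in `L^p_𝒦(ℝ^n, |·|)`. As usual for Lebesgue spaces, the values only matter
almost everywhere. -/
structure MemLK {n d : ℕ} (p : ℝ≥0∞)
    (F : EuclideanSpace ℝ (Fin n) → Set (EuclideanSpace ℝ (Fin d))) : Prop where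
  measurable : SetMeasurable F
  values : ∀ᵐ x, IsKbcs (F x)
  norm_lt_top : normLK p F < ∞

/-- Membership in `L^{p,∞}_𝒦(ℝ^n, |·|)`. -/
structure MemWeakLK {n d : ℕ} (p : ℝ)
    (F : EuclideanSpace ℝ (Fin n) → Set (EuclideanSpace ℝ (Fin d))) : Prop where
  measurable : SetMeasurable F
  values : ∀ᵐ x, IsKbcs (F x)
  norm_lt_top : normWeakLK p F < ∞

end ConvexSetValued

end

open ConvexSetValued

/-! Everything reduces to the scalar function f = |F|. The norm of an Aumann integral over Q is at
most ∫_Q f, and norm bounds on a set survive closed convex hulls, so |M_α F(x)| is controlled by the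
numbers |Q|^(α-1) ∫_Q f with x ∈ Q (`setNorm_fractionalMaximal_le`).

These are bounded by Hedberg's argument (`IsCube.setLIntegral_le`): write ∫_Q f as its power 1 - pα
times its power pα, estimate the first factor by the Hardy–Littlewood maximal function Mf and the
second by Hölder. The powers of |Q| cancel, leaving |M_α F| ≤ c (Mf)^(1-pα) ‖f‖_p^(pα). Since (1 -
pα) q = p, the strong (p,p) bound for M gives (1) for finite q; for q = ∞ the exponent of Mf is 0.
With p = 1, the weak (1,1) bound for M gives (2).

Measurability of M_α F needs a separate argument: a slight enlargement of a cube contains a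
neighbourhood of each of its points and only shrinks the average a little, so {x : M_α F(x) meets U}
is open for U open (`setMeasurable_fractionalMaximal`). -/

noncomputable section

namespace ConvexSetValued

/-! ### The Hardy–Littlewood maximal function and its weak (1,1) bound. -/

section MaximalFunction

open Metric Module

variable {E : Type*} [NormedAddCommGroup E] [NormedSpace ℝ E] [FiniteDimensional ℝ E]
  [MeasurableSpace E] [BorelSpace E] (μ : Measure E) [μ.IsAddHaarMeasure]

/-- The uncentered Hardy–Littlewood maximal function over open balls. -/
def maximalFunction {E : Type*} [NormedAddCommGroup E] [MeasurableSpace E] (μ : Measure E)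
    (f : E → ℝ≥0∞) (x : E) : ℝ≥0∞ :=
  ⨆ (c : E) (r : ℝ) (_ : x ∈ ball c r), (μ (ball c r))⁻¹ * ∫⁻ y in ball c r, f y ∂μ

theorem le_maximalFunction {E : Type*} [NormedAddCommGroup E] [MeasurableSpace E]
    (μ : Measure E) (f : E → ℝ≥0∞) {x c : E} {r : ℝ} (h : x ∈ ball c r) :
    (μ (ball c r))⁻¹ * ∫⁻ y in ball c r, f y ∂μ ≤ maximalFunction μ f x :=
  le_iSup_of_le c (le_iSup_of_le r (le_iSup_of_le h le_rfl))

theorem setOf_lt_maximalFunction {E : Type*} [NormedAddCommGroup E] [MeasurableSpace E]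
    (μ : Measure E) (f : E → ℝ≥0∞) (t : ℝ≥0∞) :
    {x | t < maximalFunction μ f x} =
      ⋃ i ∈ {i : E × ℝ | 0 < i.2 ∧
        t < (μ (ball i.1 i.2))⁻¹ * ∫⁻ y in ball i.1 i.2, f y ∂μ}, ball i.1 i.2 := by
  ext x
  simp only [maximalFunction, lt_iSup_iff, mem_ofPred_eq, mem_iUnion, exists_prop, Prod.exists]
  constructor
  · rintro ⟨c, r, h, h'⟩
    exact ⟨c, r, ⟨pos_of_mem_ball h, h'⟩, h⟩
  · rintro ⟨c, r, ⟨-, h'⟩, h⟩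
    exact ⟨c, r, h, h'⟩

/-- The balls are uncentered, so each superlevel set is a union of open balls; no measurability of f
is needed. -/
theorem measurable_maximalFunction {E : Type*} [NormedAddCommGroup E] [MeasurableSpace E]
    [BorelSpace E] (μ : Measure E) (f : E → ℝ≥0∞) : Measurable (maximalFunction μ f) := by
  refine measurable_of_Ioi fun t => ?_
  change MeasurableSet {x | t < maximalFunction μ f x}
  rw [setOf_lt_maximalFunction]
  exact (isOpen_biUnion fun _ _ => isOpen_ball).measurableSet

theorem measure_closedBall_four_mul (c : E) {r : ℝ} (hr : 0 < r) :
    μ (closedBall c (4 * r)) = 4 ^ finrank ℝ E * μ (ball c r) := by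
  rw [Measure.addHaar_closedBall μ c (by positivity), Measure.addHaar_ball_of_pos μ c hr, mul_pow,
    ENNReal.ofReal_mul (by positivity), mul_assoc, ENNReal.ofReal_pow (by norm_num)]
  simp

/-- Weak type `(1,1)` estimate for a union of balls of bounded radii on which the averages of `f`
exceed `t`. -/
theorem mul_measure_biUnion_ball_le (f : E → ℝ≥0∞) (t : ℝ≥0∞) (R : ℝ) (s : Set (E × ℝ))
    (hs : ∀ i ∈ s, 0 < i.2 ∧ i.2 ≤ R ∧
      t < (μ (ball i.1 i.2))⁻¹ * ∫⁻ y in ball i.1 i.2, f y ∂μ) :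
    t * μ (⋃ i ∈ s, ball i.1 i.2) ≤ 4 ^ finrank ℝ E * ∫⁻ y, f y ∂μ := by
  -- Any enlargement factor above 3 would do in Vitali's lemma; 4 is the source of `4 ^ finrank ℝ
  -- E`.
  obtain ⟨u, hus, hdisj, hcov⟩ := Vitali.exists_disjoint_subfamily_covering_enlargement_closedBall
    s (fun i => i.1) (fun i => i.2) R (fun i hi => (hs i hi).2.1) 4 (by norm_num)
  have hdisj' : u.PairwiseDisjoint fun i : E × ℝ => ball i.1 i.2 :=
    hdisj.mono fun _ => ball_subset_closedBall
  have hcount : u.Countable := hdisj'.countable_of_isOpen (fun _ _ => isOpen_ball)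
    fun i hi => ⟨i.1, mem_ball_self (hs i (hus hi)).1⟩
  have hsub : (⋃ i ∈ s, ball i.1 i.2) ⊆ ⋃ i ∈ u, closedBall i.1 (4 * i.2) := by
    refine iUnion₂_subset fun i hi => ?_
    obtain ⟨j, hj, hij⟩ := hcov i hi
    exact (ball_subset_closedBall.trans hij).trans (subset_biUnion_of_mem (u := fun j : E × ℝ =>
      closedBall j.1 (4 * j.2)) hj)
  have := hcount.to_subtype
  calc t * μ (⋃ i ∈ s, ball i.1 i.2)
      ≤ t * ∑' i : u, μ (closedBall i.1.1 (4 * i.1.2)) := by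
        gcongr
        exact (measure_mono hsub).trans (measure_biUnion_le μ hcount _)
    _ = ∑' i : u, 4 ^ finrank ℝ E * (t * μ (ball i.1.1 i.1.2)) := by
        rw [← ENNReal.tsum_mul_left]
        congr with i
        rw [measure_closedBall_four_mul μ _ (hs _ (hus i.2)).1]
        ring
    _ ≤ ∑' i : u, 4 ^ finrank ℝ E * ∫⁻ y in ball i.1.1 i.1.2, f y ∂μ := by
        refine ENNReal.tsum_le_tsum fun i => ?_
        gcongr
        obtain ⟨h0, -, hlt⟩ := hs _ (hus i.2)
        have hpos : μ (ball i.1.1 i.1.2) ≠ 0 := (measure_ball_pos μ _ h0).ne'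
        rw [← ENNReal.le_div_iff_mul_le (Or.inl hpos) (Or.inl measure_ball_lt_top.ne),
          div_eq_mul_inv, mul_comm]
        exact hlt.le
    _ = 4 ^ finrank ℝ E * ∫⁻ y in ⋃ i ∈ u, ball i.1 i.2, f y ∂μ := by
        rw [ENNReal.tsum_mul_left, lintegral_biUnion hcount (fun _ _ => measurableSet_ball) hdisj']
    _ ≤ 4 ^ finrank ℝ E * ∫⁻ y, f y ∂μ := by
        gcongr
        exact Measure.restrict_le_self

/-- Weak type `(1,1)` of the Hardy–Littlewood maximal function. -/
theorem mul_measure_lt_maximalFunction_le (f : E → ℝ≥0∞) (t : ℝ≥0∞) :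
    t * μ {x | t < maximalFunction μ f x} ≤ 4 ^ finrank ℝ E * ∫⁻ y, f y ∂μ := by
  -- Vitali's lemma needs bounded radii, so radii are capped at N and the union is recovered by
  -- continuity from below.
  set s : ℕ → Set (E × ℝ) := fun N => {i | 0 < i.2 ∧ i.2 ≤ N ∧
    t < (μ (ball i.1 i.2))⁻¹ * ∫⁻ y in ball i.1 i.2, f y ∂μ} with hs
  have hU : {x | t < maximalFunction μ f x} = ⋃ N, ⋃ i ∈ s N, ball i.1 i.2 := by
    rw [setOf_lt_maximalFunction]
    ext x
    simp only [mem_iUnion, exists_prop, hs, mem_ofPred_eq]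
    constructor
    · rintro ⟨i, ⟨h0, h1⟩, hx⟩
      obtain ⟨N, hN⟩ := exists_nat_ge i.2
      exact ⟨N, i, ⟨h0, hN, h1⟩, hx⟩
    · rintro ⟨N, i, ⟨h0, -, h1⟩, hx⟩
      exact ⟨i, ⟨h0, h1⟩, hx⟩
  have hmono : Monotone fun N => ⋃ i ∈ s N, ball i.1 i.2 := fun N N' h =>
    biUnion_subset_biUnion_left fun i hi =>
      ⟨hi.1, hi.2.1.trans (Nat.cast_le.2 h), hi.2.2⟩
  rw [hU, hmono.measure_iUnion, ENNReal.mul_iSup]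
  exact iSup_le fun N => mul_measure_biUnion_ball_le μ f t N (s N) fun i hi => hi

/-- A constant has itself as its average over every ball. -/
theorem maximalFunction_le_add {E : Type*} [NormedAddCommGroup E] [NormedSpace ℝ E]
    [FiniteDimensional ℝ E] [MeasurableSpace E] (μ : Measure E) [μ.IsAddHaarMeasure] (f g : E → ℝ≥0∞) (t : ℝ≥0∞) (h : ∀ x, f x ≤ g x + t) (x : E) :
    maximalFunction μ f x ≤ maximalFunction μ g x + t := by
  refine iSup_le fun c => iSup_le fun r => iSup_le fun hx => ?_
  have hr := pos_of_mem_ball hx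
  calc (μ (ball c r))⁻¹ * ∫⁻ y in ball c r, f y ∂μ
      ≤ (μ (ball c r))⁻¹ * ∫⁻ y in ball c r, (g y + t) ∂μ := by gcongr; exact h _
    _ = (μ (ball c r))⁻¹ * ∫⁻ y in ball c r, g y ∂μ + t := by
        rw [lintegral_add_right _ measurable_const, setLIntegral_const, mul_add, mul_left_comm,
          ENNReal.inv_mul_cancel (measure_ball_pos μ _ hr).ne' measure_ball_lt_top.ne, mul_one]
    _ ≤ _ := by gcongr; exact le_maximalFunction μ g hx

/-! ### Layer cake and the strong (p,p) bound. -/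

theorem lintegral_ite_rpow_of_ne_top {a : ℝ} (ha : 0 < a) {g : ℝ≥0∞} (hg : g ≠ ∞) :
    ∫⁻ t in Ioi (0 : ℝ), (if ENNReal.ofReal t < g then ENNReal.ofReal (t ^ (a - 1)) else 0) =
      (ENNReal.ofReal a)⁻¹ * g ^ a := by
  lift g to ℝ≥0 using hg
  have h1 : ∀ t ∈ Ioi (0 : ℝ), (if ENNReal.ofReal t < (g : ℝ≥0∞) then
      ENNReal.ofReal (t ^ (a - 1)) else 0) =
      (Iio (g : ℝ)).indicator (fun t => ENNReal.ofReal (t ^ (a - 1))) t := by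
    intro t ht
    rw [indicator_apply]
    congr 1
    rw [← ENNReal.ofReal_coe_nnreal, ENNReal.ofReal_lt_ofReal_iff_of_nonneg (le_of_lt ht)]
    rfl
  rw [setLIntegral_congr_fun measurableSet_Ioi h1, lintegral_indicator measurableSet_Iio,
    Measure.restrict_restrict measurableSet_Iio, inter_comm, Ioi_inter_Iio,
    restrict_Ioo_eq_restrict_Ioc, ← ofReal_integral_eq_lintegral_ofReal]
  · rw [← intervalIntegral.integral_of_le g.coe_nonneg, integral_rpow (Or.inl (by linarith))]
    rw [sub_add_cancel, Real.zero_rpow ha.ne', sub_zero, div_eq_inv_mul,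
      ENNReal.ofReal_mul (by positivity), ENNReal.ofReal_inv_of_pos ha,
      ← ENNReal.ofReal_rpow_of_nonneg g.coe_nonneg ha.le]
    simp
  · rw [← IntegrableOn, ← intervalIntegrable_iff_integrableOn_Ioc_of_le g.coe_nonneg]
    exact intervalIntegral.intervalIntegrable_rpow' (by linarith)
  · filter_upwards [ae_restrict_mem measurableSet_Ioc] with t ht
    exact Real.rpow_nonneg ht.1.le _

theorem lintegral_ite_rpow {a : ℝ} (ha : 0 < a) (g : ℝ≥0∞) :
    ∫⁻ t in Ioi (0 : ℝ), (if ENNReal.ofReal t < g then ENNReal.ofReal (t ^ (a - 1)) else 0) =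
      (ENNReal.ofReal a)⁻¹ * g ^ a := by
  rcases eq_or_ne g ∞ with rfl | hg
  -- For g = ∞ both sides are infinite: compare with the finite heights N and let N tend to
  -- infinity.
  · have key : ∀ N : ℕ, (ENNReal.ofReal a)⁻¹ * (N : ℝ≥0∞) ^ a ≤ ∫⁻ t in Ioi (0 : ℝ),
        (if ENNReal.ofReal t < ∞ then ENNReal.ofReal (t ^ (a - 1)) else 0) := by
      intro N
      rw [← lintegral_ite_rpow_of_ne_top ha (ENNReal.natCast_ne_top N)]
      refine lintegral_mono fun t => ?_
      simp only [ENNReal.ofReal_lt_top, if_true]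
      split_ifs <;> simp
    have hlim : Filter.Tendsto (fun N : ℕ => (ENNReal.ofReal a)⁻¹ * (N : ℝ≥0∞) ^ a) Filter.atTop
        (nhds ((ENNReal.ofReal a)⁻¹ * ∞ ^ a)) := by
      refine ENNReal.Tendsto.const_mul ?_ (Or.inl ?_)
      · exact (ENNReal.continuous_rpow_const.tendsto _).comp ENNReal.tendsto_nat_nhds_top
      · simp [ha]
    have hle := le_of_tendsto' hlim key
    have htop : (ENNReal.ofReal a)⁻¹ * ∞ ^ a = ∞ := by
      rw [ENNReal.top_rpow_of_pos ha, ENNReal.mul_top]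
      simp
    rw [htop] at hle ⊢
    exact top_le_iff.1 hle
  · exact lintegral_ite_rpow_of_ne_top ha hg

/-- The layer cake formula for powers of extended nonnegative functions. -/
theorem lintegral_rpow_eq_lintegral_measure_lt {X : Type*} [MeasurableSpace X] (ν : Measure X)
    [SFinite ν] {g : X → ℝ≥0∞} (hg : Measurable g) {a : ℝ} (ha : 0 < a) :
    ∫⁻ x, g x ^ a ∂ν = ENNReal.ofReal a * ∫⁻ t in Ioi (0 : ℝ),
      ENNReal.ofReal (t ^ (a - 1)) * ν {x | ENNReal.ofReal t < g x} := by
  have h0 : ENNReal.ofReal a ≠ 0 := by simpa using ha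
  have h1 : ∫⁻ x, (ENNReal.ofReal a)⁻¹ * g x ^ a ∂ν = ∫⁻ t in Ioi (0 : ℝ),
      ENNReal.ofReal (t ^ (a - 1)) * ν {x | ENNReal.ofReal t < g x} := by
    simp_rw [← lintegral_ite_rpow ha]
    rw [lintegral_lintegral_swap]
    · congr with t
      have : (fun x => if ENNReal.ofReal t < g x then ENNReal.ofReal (t ^ (a - 1)) else 0) =
          {x | ENNReal.ofReal t < g x}.indicator fun _ => ENNReal.ofReal (t ^ (a - 1)) := by
        ext x
        simp [indicator_apply]
      rw [this, lintegral_indicator_const (measurableSet_lt measurable_const hg)]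
    · refine Measurable.aemeasurable (Measurable.ite (measurableSet_lt ?_ ?_) ?_ ?_) <;> fun_prop
  rw [← h1, lintegral_const_mul _ (hg.pow_const a), ← mul_assoc,
    ENNReal.mul_inv_cancel h0 ENNReal.ofReal_ne_top, one_mul]

/-- The part of f below t/2 adds at most t/2 to any average, so the weak bound at height t/2 is
needed only for the part above. This truncation is what makes the t-integral converge in the strong
bound. -/
theorem measure_lt_maximalFunction_le (f : E → ℝ≥0∞) {t : ℝ} (ht : 0 < t) :
    μ {x | ENNReal.ofReal t < maximalFunction μ f x} ≤ ENNReal.ofReal t⁻¹ *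
      (2 * 4 ^ finrank ℝ E * ∫⁻ x, (if ENNReal.ofReal t < 2 * f x then f x else 0) ∂μ) := by
  set g : E → ℝ≥0∞ := fun x => if ENNReal.ofReal t < 2 * f x then f x else 0 with hg
  set T := ENNReal.ofReal (t / 2) with hT
  have hTT : ENNReal.ofReal t = T + T := by
    rw [hT, ← ENNReal.ofReal_add (by positivity) (by positivity), add_halves]
  have hfg : ∀ x, f x ≤ g x + T := by
    intro x
    simp only [hg]
    split_ifs with h
    · exact le_self_add
    · rw [zero_add]
      rw [not_lt, hTT, two_mul] at h
      by_contra! h'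
      exact absurd h (not_le.2 (ENNReal.add_lt_add h' h'))
  have hsub : {x | ENNReal.ofReal t < maximalFunction μ f x} ⊆
      {x | T < maximalFunction μ g x} := by
    intro x hx
    have h1 := (show ENNReal.ofReal t < _ from hx).trans_le (maximalFunction_le_add μ f g T hfg x)
    rw [hTT] at h1
    exact lt_of_add_lt_add_right h1
  have hw := mul_measure_lt_maximalFunction_le μ g T
  have hmul : ENNReal.ofReal t⁻¹ * (2 * T) = 1 := by
    rw [two_mul, ← hTT, ← ENNReal.ofReal_mul (by positivity), inv_mul_cancel₀ ht.ne',
      ENNReal.ofReal_one]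
  calc μ {x | ENNReal.ofReal t < maximalFunction μ f x}
      ≤ ENNReal.ofReal t⁻¹ * (2 * T) * μ {x | T < maximalFunction μ g x} := by
        rw [hmul, one_mul]; exact measure_mono hsub
    _ = ENNReal.ofReal t⁻¹ * (2 * (T * μ {x | T < maximalFunction μ g x})) := by ring
    _ ≤ _ := by rw [mul_assoc 2]; gcongr

/-- Strong type `(p,p)` of the Hardy–Littlewood maximal function, `1 < p < ∞`. -/
theorem exists_lintegral_maximalFunction_rpow_le {p : ℝ} (hp : 1 < p) :
    ∃ C : ℝ≥0∞, C ≠ ∞ ∧ ∀ f : E → ℝ≥0∞, Measurable f →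
      ∫⁻ x, maximalFunction μ f x ^ p ∂μ ≤ C * ∫⁻ x, f x ^ p ∂μ := by
  have hp1 : 0 < p - 1 := by linarith
  set A : ℝ≥0∞ := 2 * 4 ^ finrank ℝ E with hA
  have hAtop : A ≠ ∞ := by rw [hA]; exact ENNReal.mul_ne_top (by simp) (by simp)
  -- The factor p comes from the layer cake, A from the truncated weak bound, and 2^(p-1)/(p-1) from
  -- integrating t^(p-2) up to 2 f(x).
  refine ⟨ENNReal.ofReal p * (A * ((ENNReal.ofReal (p - 1))⁻¹ * 2 ^ (p - 1))), ?_, fun f hf => ?_⟩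
  · refine ENNReal.mul_ne_top ENNReal.ofReal_ne_top (ENNReal.mul_ne_top hAtop
      (ENNReal.mul_ne_top ?_ (ENNReal.rpow_ne_top_of_nonneg hp1.le (by simp))))
    simpa using hp
  rw [lintegral_rpow_eq_lintegral_measure_lt μ (measurable_maximalFunction μ f) (by linarith),
    mul_assoc]
  gcongr
  have hpt : ∀ x, f x * ∫⁻ t in Ioi (0 : ℝ),
      (if ENNReal.ofReal t < 2 * f x then ENNReal.ofReal (t ^ (p - 1 - 1)) else 0) =
      ((ENNReal.ofReal (p - 1))⁻¹ * 2 ^ (p - 1)) * f x ^ p := by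
    intro x
    rw [lintegral_ite_rpow hp1, ENNReal.mul_rpow_of_nonneg _ _ hp1.le]
    have : f x ^ p = f x * f x ^ (p - 1) := by
      conv_rhs => rw [← ENNReal.rpow_one (f x), ← ENNReal.rpow_mul, one_mul]
      rw [← ENNReal.rpow_add_of_nonneg _ _ zero_le_one hp1.le, add_sub_cancel]
    rw [this]
    ring
  calc ∫⁻ t in Ioi (0 : ℝ), ENNReal.ofReal (t ^ (p - 1)) *
        μ {x | ENNReal.ofReal t < maximalFunction μ f x}
      ≤ ∫⁻ t in Ioi (0 : ℝ), A * ∫⁻ x, (if ENNReal.ofReal t < 2 * f x then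
          ENNReal.ofReal (t ^ (p - 1 - 1)) else 0) * f x ∂μ := by
        refine setLIntegral_mono' measurableSet_Ioi fun t (ht : 0 < t) => ?_
        have hrw : ENNReal.ofReal (t ^ (p - 1 - 1)) =
            ENNReal.ofReal (t ^ (p - 1)) * ENNReal.ofReal t⁻¹ := by
          rw [Real.rpow_sub_one ht.ne', div_eq_mul_inv, ENNReal.ofReal_mul (by positivity)]
        have hint : ∫⁻ x, (if ENNReal.ofReal t < 2 * f x then
            ENNReal.ofReal (t ^ (p - 1 - 1)) else 0) * f x ∂μ =
            ENNReal.ofReal (t ^ (p - 1 - 1)) *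
              ∫⁻ x, (if ENNReal.ofReal t < 2 * f x then f x else 0) ∂μ := by
          rw [← lintegral_const_mul' _ _ ENNReal.ofReal_ne_top]
          congr with x
          split_ifs <;> simp
        rw [hint, hrw]
        calc _ ≤ ENNReal.ofReal (t ^ (p - 1)) * (ENNReal.ofReal t⁻¹ *
              (A * ∫⁻ x, (if ENNReal.ofReal t < 2 * f x then f x else 0) ∂μ)) := by
              gcongr
              exact measure_lt_maximalFunction_le μ f ht
          _ = _ := by ring
    _ = A * ∫⁻ x, f x * (∫⁻ t in Ioi (0 : ℝ),
          (if ENNReal.ofReal t < 2 * f x then ENNReal.ofReal (t ^ (p - 1 - 1)) else 0)) ∂μ := by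
        have hm : Measurable fun z : ℝ × E => (if ENNReal.ofReal z.1 < 2 * f z.2 then
            ENNReal.ofReal (z.1 ^ (p - 1 - 1)) else 0) := by
          refine Measurable.ite (measurableSet_lt ?_ ?_) ?_ ?_ <;> fun_prop
        rw [lintegral_const_mul' _ _ hAtop, lintegral_lintegral_swap]
        · congr with x
          rw [lintegral_mul_const, mul_comm]
          exact hm.comp (measurable_id.prodMk measurable_const)
        · exact (hm.mul (hf.comp measurable_snd)).aemeasurable
    _ = _ := by
        simp_rw [hpt]
        rw [lintegral_const_mul _ (hf.pow_const p), ← mul_assoc]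

end MaximalFunction

end ConvexSetValued

end

noncomputable section

namespace ConvexSetValued

open Filter Topology

variable {n d : ℕ}

/-! ### Cubes compared with balls, and the Hedberg estimate. -/

theorem volume_cube (a : EuclideanSpace ℝ (Fin n)) {l : ℝ} (hl : 0 < l) :
    volume {x : EuclideanSpace ℝ (Fin n) | ∀ i, a i ≤ x i ∧ x i < a i + l} =
      ENNReal.ofReal (l ^ n) := by
  have : {x : EuclideanSpace ℝ (Fin n) | ∀ i, a i ≤ x i ∧ x i < a i + l} =
      (WithLp.ofLp : EuclideanSpace ℝ (Fin n) → Fin n → ℝ) ⁻¹'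
        (univ.pi fun i => Ico (a i) (a i + l)) := by
    ext x
    simp
  rw [this, (PiLp.volume_preserving_ofLp (Fin n)).measure_preimage
    (MeasurableSet.univ_pi fun _ => measurableSet_Ico).nullMeasurableSet, Real.volume_pi_Ico,
    ENNReal.ofReal_pow hl.le]
  simp

theorem IsCube.measurableSet {Q : Set (EuclideanSpace ℝ (Fin n))} (hQ : IsCube Q) :
    MeasurableSet Q := by
  obtain ⟨a, l, -, rfl⟩ := hQ
  have : {x : EuclideanSpace ℝ (Fin n) | ∀ i, a i ≤ x i ∧ x i < a i + l} =
      ⋂ i, (fun x : EuclideanSpace ℝ (Fin n) => x i) ⁻¹' Ico (a i) (a i + l) := by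
    ext x
    simp
  rw [this]
  exact MeasurableSet.iInter fun i => (by fun_prop : Measurable fun x :
    EuclideanSpace ℝ (Fin n) => x i) measurableSet_Ico

theorem IsCube.volume_ne_top {Q : Set (EuclideanSpace ℝ (Fin n))} (hQ : IsCube Q) :
    volume Q ≠ ∞ := by
  obtain ⟨a, l, hl, rfl⟩ := hQ
  simp [volume_cube a hl]

theorem IsCube.volume_ne_zero {Q : Set (EuclideanSpace ℝ (Fin n))} (hQ : IsCube Q) :
    volume Q ≠ 0 := by
  obtain ⟨a, l, hl, rfl⟩ := hQ
  rw [volume_cube a hl]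
  simp only [ne_eq, ENNReal.ofReal_eq_zero, not_le]
  positivity

theorem IsCube.volume_real_pos {Q : Set (EuclideanSpace ℝ (Fin n))} (hQ : IsCube Q) :
    0 < volume.real Q :=
  ENNReal.toReal_pos hQ.volume_ne_zero hQ.volume_ne_top

/-- The ratio of the volumes of a ball of radius `(n + 1) l` and a cube of side length `l`. -/
def ballCubeRatio (n : ℕ) : ℝ≥0∞ :=
  ENNReal.ofReal (((n : ℝ) + 1) ^ n) * volume (Metric.ball (0 : EuclideanSpace ℝ (Fin n)) 1)

theorem ballCubeRatio_ne_top : ballCubeRatio n ≠ ∞ :=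
  ENNReal.mul_ne_top ENNReal.ofReal_ne_top measure_ball_lt_top.ne

theorem IsCube.exists_subset_ball {Q : Set (EuclideanSpace ℝ (Fin n))} (hQ : IsCube Q)
    {x : EuclideanSpace ℝ (Fin n)} (hx : x ∈ Q) :
    ∃ r, 0 < r ∧ Q ⊆ Metric.ball x r ∧ volume (Metric.ball x r) = ballCubeRatio n * volume Q := by
  obtain ⟨a, l, hl, rfl⟩ := hQ
  refine ⟨(n + 1) * l, by positivity, fun y hy => ?_, ?_⟩
  · rw [mem_ball_iff_norm]
    -- The diameter is at most √n l; the radius (n + 1) l keeps the inequality strict, also for n =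
    -- 0.
    refine lt_of_pow_lt_pow_left₀ 2 (by positivity) ?_
    rw [EuclideanSpace.norm_sq_eq]
    calc ∑ i, ‖(y - x) i‖ ^ 2 ≤ ∑ _i : Fin n, l ^ 2 := by
          refine Finset.sum_le_sum fun i _ => ?_
          have h1 := hx i
          have h2 := hy i
          gcongr
          rw [PiLp.sub_apply, Real.norm_eq_abs, abs_le]
          constructor <;> linarith
      _ = n * l ^ 2 := by simp
      _ < ((n + 1) * l) ^ 2 := by
          have : 0 < l ^ 2 := by positivity
          have hn : (0 : ℝ) ≤ n := by positivity
          nlinarith [mul_nonneg hn hn, mul_nonneg hn this.le, mul_nonneg (mul_nonneg hn hn) this.le]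
  · rw [Measure.addHaar_ball_of_pos _ _ (by positivity), volume_cube a hl, finrank_euclideanSpace,
      Fintype.card_fin, mul_pow, ENNReal.ofReal_mul (by positivity), ballCubeRatio]
    ring

/-- Hölder's inequality against the constant 1 on s. -/
theorem setLIntegral_le_rpow_mul {X : Type*} [MeasurableSpace X] (μ : Measure X)
    {f : X → ℝ≥0∞} (hf : Measurable f) {p : ℝ} (hp : 1 ≤ p) (s : Set X) :
    ∫⁻ x in s, f x ∂μ ≤ (∫⁻ x, f x ^ p ∂μ) ^ (1 / p) * μ s ^ (1 - 1 / p) := by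
  have h := eLpNorm'_le_eLpNorm'_mul_rpow_measure_univ (μ := μ.restrict s) (f := f) one_pos hp
    hf.aestronglyMeasurable
  simp only [eLpNorm', enorm_eq_self, ENNReal.rpow_one, div_one, Measure.restrict_apply_univ] at h
  refine h.trans ?_
  gcongr
  exact Measure.restrict_le_self

/-- The fractional averages of `f` are controlled by its maximal function and its `L^p` norm. -/
theorem IsCube.setLIntegral_le {Q : Set (EuclideanSpace ℝ (Fin n))} (hQ : IsCube Q)
    {x : EuclideanSpace ℝ (Fin n)} (hx : x ∈ Q) {f : EuclideanSpace ℝ (Fin n) → ℝ≥0∞}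
    (hf : Measurable f) {p α : ℝ} (hp : 1 ≤ p) (hα : 0 ≤ α) (hpα : p * α ≤ 1) :
    ∫⁻ y in Q, f y ≤ volume Q ^ (1 - α) * (ballCubeRatio n ^ (1 - p * α) *
      maximalFunction volume f x ^ (1 - p * α) * (∫⁻ y, f y ^ p) ^ α) := by
  obtain ⟨r, hr, hsub, hvol⟩ := hQ.exists_subset_ball hx
  set I := ∫⁻ y in Q, f y
  set V := volume Q
  have hp0 : 0 < p := by linarith
  have h1 : I ≤ ballCubeRatio n * V * maximalFunction volume f x := by
    have h := le_maximalFunction volume f (Metric.mem_ball_self (x := x) hr)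
    have hB0 : volume (Metric.ball x r) ≠ 0 := (Metric.measure_ball_pos _ _ hr).ne'
    calc I ≤ ∫⁻ y in Metric.ball x r, f y := lintegral_mono_set hsub
      _ = volume (Metric.ball x r) *
          ((volume (Metric.ball x r))⁻¹ * ∫⁻ y in Metric.ball x r, f y) := by
          rw [← mul_assoc, ENNReal.mul_inv_cancel hB0 measure_ball_lt_top.ne, one_mul]
      _ ≤ _ := by rw [← hvol]; gcongr
  have h2 := setLIntegral_le_rpow_mul volume hf hp Q
  have hs : 0 ≤ 1 - p * α := by linarith
  have hpa : 0 ≤ p * α := by positivity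
  -- The first factor takes the maximal function bound and the second the Hölder bound; the
  -- exponents of |Q| then add up to 1 - α.
  calc I = I ^ (1 - p * α) * I ^ (p * α) := by
        rw [← ENNReal.rpow_add_of_nonneg _ _ hs hpa, sub_add_cancel, ENNReal.rpow_one]
    _ ≤ (ballCubeRatio n * V * maximalFunction volume f x) ^ (1 - p * α) *
        ((∫⁻ y, f y ^ p) ^ (1 / p) * V ^ (1 - 1 / p)) ^ (p * α) := by
        gcongr
    _ = _ := by
        rw [ENNReal.mul_rpow_of_nonneg _ _ hs, ENNReal.mul_rpow_of_nonneg _ _ hs,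
          ENNReal.mul_rpow_of_nonneg _ _ hpa, ← ENNReal.rpow_mul, ← ENNReal.rpow_mul]
        have e1 : 1 / p * (p * α) = α := by field_simp
        have e2 : V ^ (1 - α) = V ^ (1 - p * α) * V ^ ((1 - 1 / p) * (p * α)) := by
          rw [← ENNReal.rpow_add _ _ hQ.volume_ne_zero hQ.volume_ne_top]
          congr 1
          field_simp
          ring
        rw [e1, e2]
        ring

/-! ### The norm of a set, and local integrable boundedness. -/

theorem enorm_le_setNorm {K : Set (EuclideanSpace ℝ (Fin d))} {v : EuclideanSpace ℝ (Fin d)}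
    (hv : v ∈ K) : ‖v‖ₑ ≤ setNorm K :=
  le_iSup₂ (f := fun v (_ : v ∈ K) => ‖v‖ₑ) v hv

theorem lt_setNorm_iff {K : Set (EuclideanSpace ℝ (Fin d))} {t : ℝ≥0∞} :
    t < setNorm K ↔ (K ∩ {v | t < ‖v‖ₑ}).Nonempty := by
  simp [setNorm, lt_iSup_iff, Set.Nonempty]

theorem isBounded_of_setNorm_lt_top {K : Set (EuclideanSpace ℝ (Fin d))} (h : setNorm K < ∞) :
    Bornology.IsBounded K := by
  refine isBounded_iff_forall_norm_le.2 ⟨(setNorm K).toReal, fun v hv => ?_⟩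
  rw [← toReal_enorm]
  exact ENNReal.toReal_mono h.ne (enorm_le_setNorm hv)

theorem IsKbcs.setNorm_lt_top {K : Set (EuclideanSpace ℝ (Fin d))} (h : IsKbcs K) :
    setNorm K < ∞ := by
  obtain ⟨C, hC⟩ := isBounded_iff_forall_norm_le.1 h.isBounded
  refine (iSup₂_le fun v hv => ?_).trans_lt (ENNReal.ofReal_lt_top (r := C))
  rw [← ofReal_norm]
  exact ENNReal.ofReal_le_ofReal (hC v hv)

theorem IsKbcs.zero_mem {K : Set (EuclideanSpace ℝ (Fin d))} (h : IsKbcs K) : 0 ∈ K := by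
  obtain ⟨v, hv⟩ := h.nonempty
  have hv' : -v ∈ K := by rw [← h.symmetric]; simpa using hv
  have := h.convex hv hv' (by norm_num : (0 : ℝ) ≤ 1 / 2) (by norm_num : (0 : ℝ) ≤ 1 / 2)
    (by norm_num)
  simpa using this

/-- A closed ball about 0 is closed and convex, so it contains the closed convex hull of any subset.
-/
theorem setNorm_closure_convexHull_le {S : Set (EuclideanSpace ℝ (Fin d))} {B : ℝ≥0∞}
    (h : ∀ v ∈ S, ‖v‖ₑ ≤ B) : setNorm (closure (convexHull ℝ S)) ≤ B := by
  rcases eq_or_ne B ∞ with rfl | hB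
  · exact le_top
  lift B to ℝ≥0 using hB
  have hsub : closure (convexHull ℝ S) ⊆ Metric.closedBall 0 B := by
    refine closure_minimal (convexHull_min (fun v hv => ?_) (convex_closedBall _ _))
      Metric.isClosed_closedBall
    have := h v hv
    rw [mem_closedBall_zero_iff]
    rwa [enorm_eq_nnnorm, ENNReal.coe_le_coe] at this
  refine iSup₂_le fun v hv => ?_
  have := hsub hv
  rw [mem_closedBall_zero_iff] at this
  rwa [enorm_eq_nnnorm, ENNReal.coe_le_coe]

/-- The set where |F| > t is the set where F meets the open set {|v| > t}. -/
theorem SetMeasurable.aemeasurable_setNorm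
    {F : EuclideanSpace ℝ (Fin n) → Set (EuclideanSpace ℝ (Fin d))} (hF : SetMeasurable F) :
    AEMeasurable (fun x => setNorm (F x)) volume := by
  refine NullMeasurable.aemeasurable ?_
  refine measurable_of_Ioi (δ := NullMeasurableSpace (EuclideanSpace ℝ (Fin n)) volume)
    fun t => ?_
  have h : NullMeasurableSet ((fun x => setNorm (F x)) ⁻¹' Ioi t) volume := by
    convert hF _ (isOpen_lt (continuous_const (y := t)) continuous_enorm) using 1
    ext x
    exact lt_setNorm_iff
  exact h

theorem MemLK.locallyIntegrablyBounded {p : ℝ≥0∞} (hp : 1 ≤ p)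
    {F : EuclideanSpace ℝ (Fin n) → Set (EuclideanSpace ℝ (Fin d))} (hF : MemLK p F) :
    LocallyIntegrablyBounded F := by
  have hm := hF.measurable.aemeasurable_setNorm
  -- The added 1 puts F(x) inside an open ball even when the supremum |F(x)| is attained.
  refine ⟨hF.measurable, fun x => (setNorm (F x)).toReal + 1, fun x => by positivity, ?_, ?_⟩
  · refine LocallyIntegrable.add ?_ (locallyIntegrable_const 1)
    refine MemLp.locallyIntegrable (p := p) ⟨hm.ennreal_toReal.aestronglyMeasurable, ?_⟩ hp
    refine lt_of_le_of_lt (eLpNorm_mono_enorm fun x => ?_) hF.norm_lt_top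
    rw [enorm_eq_self, Real.enorm_of_nonneg ENNReal.toReal_nonneg]
    exact ENNReal.ofReal_toReal_le
  · filter_upwards [hF.values] with x hx v hv
    rw [mem_ball_zero_iff]
    refine lt_of_le_of_lt ?_ (lt_add_one _)
    rw [← toReal_enorm]
    exact ENNReal.toReal_mono hx.setNorm_lt_top.ne (enorm_le_setNorm hv)

/-! ### Stability properties of the Aumann integral. -/

section Aumann

variable {F : EuclideanSpace ℝ (Fin n) → Set (EuclideanSpace ℝ (Fin d))}
  {Q Q' : Set (EuclideanSpace ℝ (Fin n))} {v : EuclideanSpace ℝ (Fin d)}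

theorem enorm_le_of_mem_aumannIntegral (hv : v ∈ aumannIntegral Q F) :
    ‖v‖ₑ ≤ ∫⁻ x in Q, setNorm (F x) := by
  obtain ⟨f, -, hfF, rfl⟩ := hv
  refine (enorm_integral_le_lintegral_enorm _).trans (lintegral_mono_ae ?_)
  filter_upwards [hfF] with x hx using enorm_le_setNorm hx

theorem zero_mem_aumannIntegral (hF : ∀ᵐ x, IsKbcs (F x)) : 0 ∈ aumannIntegral Q F := by
  refine ⟨fun _ => 0, integrableOn_zero, ae_restrict_of_ae ?_, by simp⟩
  filter_upwards [hF] with x hx using hx.zero_mem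

theorem smul_mem_aumannIntegral (hF : ∀ᵐ x, IsKbcs (F x)) (hv : v ∈ aumannIntegral Q F) {t : ℝ}
    (h0 : 0 ≤ t) (h1 : t ≤ 1) : t • v ∈ aumannIntegral Q F := by
  obtain ⟨f, hf, hfF, rfl⟩ := hv
  refine ⟨fun x => t • f x, hf.smul t, ?_, integral_smul _ _⟩
  filter_upwards [hfF, ae_restrict_of_ae hF] with x hx hK
  exact hK.convex.smul_mem_of_zero_mem hK.zero_mem hx ⟨h0, h1⟩

theorem neg_mem_aumannIntegral (hF : ∀ᵐ x, IsKbcs (F x)) (hv : v ∈ aumannIntegral Q F) :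
    -v ∈ aumannIntegral Q F := by
  obtain ⟨f, hf, hfF, rfl⟩ := hv
  refine ⟨fun x => -f x, hf.neg, ?_, integral_neg _⟩
  filter_upwards [hfF, ae_restrict_of_ae hF] with x hx hK
  rw [← hK.symmetric]
  simpa using hx

/-- Selections extend by zero, so the Aumann integral is monotone in the domain. -/
theorem aumannIntegral_mono (hF : ∀ᵐ x, IsKbcs (F x)) (hQ : MeasurableSet Q) (h : Q ⊆ Q') :
    aumannIntegral Q F ⊆ aumannIntegral Q' F := by
  rintro _ ⟨f, hf, hfF, rfl⟩
  refine ⟨Q.indicator f, ((integrable_indicator_iff hQ).2 hf).integrableOn, ?_, ?_⟩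
  · refine ae_restrict_of_ae ?_
    filter_upwards [(ae_restrict_iff' hQ).1 hfF, hF] with x hx hK
    by_cases hxQ : x ∈ Q
    · rw [indicator_of_mem hxQ]
      exact hx hxQ
    · rw [indicator_of_notMem hxQ]
      exact hK.zero_mem
  · rw [setIntegral_indicator hQ, inter_eq_self_of_subset_right h]

end Aumann

/-! ### Measurability, values and pointwise size of the fractional maximal operator. -/

section FractionalMaximal

variable {F : EuclideanSpace ℝ (Fin n) → Set (EuclideanSpace ℝ (Fin d))} {α : ℝ}
  {Q : Set (EuclideanSpace ℝ (Fin n))} {x : EuclideanSpace ℝ (Fin n)}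
  {v : EuclideanSpace ℝ (Fin d)}

/-- The union of the fractional averages over all cubes. -/
def averagesUnion {n d : ℕ} (α : ℝ)
    (F : EuclideanSpace ℝ (Fin n) → Set (EuclideanSpace ℝ (Fin d)))
    (x : EuclideanSpace ℝ (Fin n)) : Set (EuclideanSpace ℝ (Fin d)) :=
  ⋃ (Q : Set (EuclideanSpace ℝ (Fin n))) (_ : IsCube Q), fractionalAverage Q α F x

theorem fractionalMaximal_eq (x : EuclideanSpace ℝ (Fin n)) :
    fractionalMaximal α F x = closure (convexHull ℝ (averagesUnion α F x)) := rfl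

theorem fractionalAverage_of_mem (hx : x ∈ Q) :
    fractionalAverage Q α F x = (1 / (volume.real Q) ^ (1 - α)) • aumannIntegral Q F := by
  rw [fractionalAverage, indicator_of_mem hx, one_smul]

theorem eq_zero_of_mem_fractionalAverage (hx : x ∉ Q) (hv : v ∈ fractionalAverage Q α F x) :
    v = 0 := by
  rw [fractionalAverage, indicator_of_notMem hx] at hv
  exact zero_smul_set_subset _ hv

theorem zero_mem_averagesUnion (hF : ∀ᵐ x, IsKbcs (F x)) : 0 ∈ averagesUnion α F x := by
  refine mem_iUnion₂.2 ⟨_, ⟨0, 1, one_pos, rfl⟩, ?_⟩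
  exact zero_mem_smul_set (zero_mem_smul_set (zero_mem_aumannIntegral hF))

theorem neg_averagesUnion (hF : ∀ᵐ x, IsKbcs (F x)) :
    -averagesUnion α F x = averagesUnion α F x := by
  have key : averagesUnion α F x ⊆ -averagesUnion α F x := by
    intro v hv
    obtain ⟨Q, hQ, hv⟩ := mem_iUnion₂.1 hv
    obtain ⟨_, ⟨u, hu, rfl⟩, rfl⟩ := hv
    refine mem_iUnion₂.2 ⟨Q, hQ, ?_⟩
    refine ⟨_, ⟨-u, neg_mem_aumannIntegral hF hu, rfl⟩, ?_⟩
    simp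
  exact (Set.neg_subset.2 key).antisymm key

/-- The union of averages varies in a lower semicontinuous way, up to a contraction. -/
theorem eventually_smul_mem_averagesUnion (hF : ∀ᵐ x, IsKbcs (F x))
    (hv : v ∈ averagesUnion α F x) {t : ℝ} (h0 : 0 ≤ t) (h1 : t < 1) :
    ∀ᶠ y in 𝓝 x, t • v ∈ averagesUnion α F y := by
  obtain ⟨Q, hQ, hv⟩ := mem_iUnion₂.1 hv
  by_cases hx : x ∈ Q
  swap
  · rw [eq_zero_of_mem_fractionalAverage hx hv, smul_zero]
    exact Eventually.of_forall fun y => zero_mem_averagesUnion hF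
  rw [fractionalAverage_of_mem hx] at hv
  obtain ⟨w, hw, rfl⟩ := hv
  have hQ' := hQ
  obtain ⟨a, l, hl, rfl⟩ := hQ
  have hreal : ∀ (b : EuclideanSpace ℝ (Fin n)) {m : ℝ}, 0 < m →
      volume.real {x : EuclideanSpace ℝ (Fin n) | ∀ i, b i ≤ x i ∧ x i < b i + m} = m ^ n := by
    intro b m hm
    rw [measureReal_def, volume_cube b hm, ENNReal.toReal_ofReal (by positivity)]
  -- Growing the cube by ε on each side multiplies the normalizing factor by a ratio tending to 1 as
  -- ε → 0; the slack t < 1 absorbs it.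
  obtain ⟨ε, hε, hεt⟩ : ∃ ε : ℝ, 0 < ε ∧
      t * (((l + 2 * ε) ^ n) ^ (1 - α) / (l ^ n) ^ (1 - α)) ≤ 1 := by
    have hc : ContinuousAt (fun ε : ℝ =>
        t * (((l + 2 * ε) ^ n) ^ (1 - α) / (l ^ n) ^ (1 - α))) 0 := by
      refine continuousAt_const.mul (ContinuousAt.div_const (ContinuousAt.rpow_const ?_ ?_) _)
      · fun_prop
      · left
        simpa using fun h : l = 0 => absurd h hl.ne'
    have hlt : t * (((l + 2 * 0) ^ n) ^ (1 - α) / (l ^ n) ^ (1 - α)) < 1 := by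
      rw [mul_zero, add_zero, div_self (by positivity), mul_one]
      exact h1
    have hev := (hc.eventually (gt_mem_nhds hlt)).filter_mono (nhdsWithin_le_nhds (s := Ioi 0))
    obtain ⟨ε, h, hε⟩ := (hev.and (self_mem_nhdsWithin (s := Ioi (0 : ℝ)))).exists
    exact ⟨ε, hε, le_of_lt h⟩
  set b : EuclideanSpace ℝ (Fin n) := WithLp.toLp 2 fun i => a i - ε
  have hbi : ∀ i, b i = a i - ε := fun i => rfl
  have hl' : 0 < l + 2 * ε := by positivity
  have hev : ∀ᶠ y in 𝓝 x,
      y ∈ {z : EuclideanSpace ℝ (Fin n) | ∀ i, b i ≤ z i ∧ z i < b i + (l + 2 * ε)} := by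
    refine eventually_all.2 fun i => ?_
    have hci : ContinuousAt (fun y : EuclideanSpace ℝ (Fin n) => y i) x := by fun_prop
    have hxi := hx i
    have hlo : b i < x i := by rw [hbi]; linarith
    have hhi : x i < b i + (l + 2 * ε) := by rw [hbi]; linarith
    filter_upwards [hci.eventually (lt_mem_nhds hlo), hci.eventually (gt_mem_nhds hhi)] with y h h'
    exact ⟨h.le, h'⟩
  refine hev.mono fun y hy => ?_
  refine mem_iUnion₂.2 ⟨_, ⟨b, l + 2 * ε, hl', rfl⟩, ?_⟩
  rw [fractionalAverage_of_mem hy, hreal b hl']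
  -- The scalar compensates for the larger normalization; being at most 1, it keeps the vector in
  -- the Aumann integral.
  refine ⟨(t * (((l + 2 * ε) ^ n) ^ (1 - α) / (l ^ n) ^ (1 - α))) • w, ?_, ?_⟩
  · refine aumannIntegral_mono hF hQ'.measurableSet ?_
      (smul_mem_aumannIntegral hF hw (by positivity) hεt)
    intro z hz i
    have := hz i
    rw [hbi]
    constructor <;> linarith
  · simp only [hreal a hl, smul_smul]
    congr 1
    have : 0 < ((l + 2 * ε) ^ n) ^ (1 - α) := by positivity
    field_simp

/-- The vectors with this property form a convex set, because two neighbourhoods can be intersected;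
so it suffices to treat the generators. -/
theorem eventually_smul_mem_convexHull (hF : ∀ᵐ x, IsKbcs (F x))
    (hv : v ∈ convexHull ℝ (averagesUnion α F x)) {t : ℝ} (h0 : 0 ≤ t) (h1 : t < 1) :
    ∀ᶠ y in 𝓝 x, t • v ∈ convexHull ℝ (averagesUnion α F y) := by
  have hsub : convexHull ℝ (averagesUnion α F x) ⊆
      {v | ∀ᶠ y in 𝓝 x, t • v ∈ convexHull ℝ (averagesUnion α F y)} := by
    refine convexHull_min (fun v hv => ?_) ?_
    · filter_upwards [eventually_smul_mem_averagesUnion hF hv h0 h1] with y hy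
      exact subset_convexHull ℝ _ hy
    · intro v hv w hw a b ha hb hab
      filter_upwards [hv, hw] with y hvy hwy
      rw [smul_add, smul_comm t a, smul_comm t b]
      exact convex_convexHull ℝ _ hvy hwy ha hb hab
  exact hsub hv

/-- An open U meeting the closure contains a point v of the hull itself, and also t v for t < 1
close to 1. That t v stays in the hull at all nearby points, so the set in question is open. -/
theorem setMeasurable_fractionalMaximal (hF : ∀ᵐ x, IsKbcs (F x)) :
    SetMeasurable (fractionalMaximal α F) := by
  intro U hU
  refine (IsOpen.measurableSet ?_).nullMeasurableSet
  refine isOpen_iff_mem_nhds.2 fun x hx => ?_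
  obtain ⟨v, hv, hvU⟩ := (closure_inter_open_nonempty_iff hU).1 hx
  have hc : ContinuousAt (fun t : ℝ => t • v) 1 := by fun_prop
  have hev : ∀ᶠ t in 𝓝[<] (1 : ℝ), t • v ∈ U :=
    (hc.eventually (by simpa using hU.mem_nhds hvU)).filter_mono nhdsWithin_le_nhds
  obtain ⟨t, htU, ht0, ht1⟩ := (hev.and (Ico_mem_nhdsLT (zero_lt_one' ℝ))).exists
  filter_upwards [eventually_smul_mem_convexHull hF hv ht0 ht1] with y hy
  exact ⟨t • v, subset_closure hy, htU⟩

theorem isKbcs_fractionalMaximal (hF : ∀ᵐ x, IsKbcs (F x))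
    (hx : setNorm (fractionalMaximal α F x) < ∞) : IsKbcs (fractionalMaximal α F x) where
  nonempty := ⟨0, subset_closure (subset_convexHull ℝ _ (zero_mem_averagesUnion hF))⟩
  isClosed := isClosed_closure
  isBounded := isBounded_of_setNorm_lt_top hx
  convex := (convex_convexHull ℝ _).closure
  symmetric := by
    rw [fractionalMaximal_eq, neg_closure, ← convexHull_neg, neg_averagesUnion hF]

theorem setNorm_fractionalMaximal_le {B : ℝ≥0∞}
    (h : ∀ Q, IsCube Q → x ∈ Q → ∫⁻ y in Q, setNorm (F y) ≤ volume Q ^ (1 - α) * B) :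
    setNorm (fractionalMaximal α F x) ≤ B := by
  refine setNorm_closure_convexHull_le fun v hv => ?_
  obtain ⟨Q, hQ, hv⟩ := mem_iUnion₂.1 hv
  by_cases hx : x ∈ Q
  swap
  · simp [eq_zero_of_mem_fractionalAverage hx hv]
  rw [fractionalAverage_of_mem hx] at hv
  obtain ⟨w, hw, rfl⟩ := hv
  have hV := hQ.volume_real_pos
  have hV' : ‖1 / volume.real Q ^ (1 - α)‖ₑ = (volume Q ^ (1 - α))⁻¹ := by
    rw [Real.enorm_of_nonneg (by positivity), one_div, ENNReal.ofReal_inv_of_pos (by positivity),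
      ← ENNReal.ofReal_rpow_of_pos hV, measureReal_def, ENNReal.ofReal_toReal hQ.volume_ne_top]
  have h0 : volume Q ^ (1 - α) ≠ 0 :=
    (ENNReal.rpow_pos (pos_iff_ne_zero.2 hQ.volume_ne_zero) hQ.volume_ne_top).ne'
  have htop : volume Q ^ (1 - α) ≠ ∞ :=
    ENNReal.rpow_ne_top_of_ne_zero hQ.volume_ne_zero hQ.volume_ne_top
  simp only [enorm_smul, hV']
  calc (volume Q ^ (1 - α))⁻¹ * ‖w‖ₑ
      ≤ (volume Q ^ (1 - α))⁻¹ * (volume Q ^ (1 - α) * B) := by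
        gcongr
        exact (enorm_le_of_mem_aumannIntegral hw).trans (h Q hQ hx)
    _ = B := by rw [← mul_assoc, ENNReal.inv_mul_cancel h0 htop, one_mul]

theorem setNorm_fractionalMaximal_le_maximalFunction {f : EuclideanSpace ℝ (Fin n) → ℝ≥0∞}
    (hf : Measurable f) (hfF : (fun x => setNorm (F x)) =ᵐ[volume] f) {p : ℝ} (hp : 1 ≤ p)
    (hα : 0 ≤ α) (hpα : p * α ≤ 1) (x : EuclideanSpace ℝ (Fin n)) :
    setNorm (fractionalMaximal α F x) ≤ ballCubeRatio n ^ (1 - p * α) *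
      maximalFunction volume f x ^ (1 - p * α) * (∫⁻ y, f y ^ p) ^ α := by
  refine setNorm_fractionalMaximal_le fun Q hQ hx => ?_
  rw [lintegral_congr_ae (ae_restrict_of_ae hfF)]
  exact hQ.setLIntegral_le hx hf hp hα hpα

end FractionalMaximal

end ConvexSetValued

end

/-! ### Norm estimates and membership in the target spaces. -/

namespace ConvexSetValued

variable {n d : ℕ} {F : EuclideanSpace ℝ (Fin n) → Set (EuclideanSpace ℝ (Fin d))}

theorem ae_setNorm_lt_top_of_normLK_lt_top {q : ℝ≥0∞} (hq : q ≠ 0) (hF : SetMeasurable F)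
    (h : normLK q F < ∞) : ∀ᵐ x, setNorm (F x) < ∞ := by
  rcases eq_or_ne q ∞ with rfl | hq'
  · rw [normLK, eLpNorm_exponent_top] at h
    filter_upwards [ae_le_eLpNormEssSup (f := fun x => setNorm (F x)) (μ := volume)] with x hx
    exact lt_of_le_of_lt hx h
  · have hq0 : 0 < q.toReal := ENNReal.toReal_pos hq hq'
    have hfin := lintegral_rpow_enorm_lt_top_of_eLpNorm_lt_top hq hq' h
    filter_upwards [ae_lt_top' (hF.aemeasurable_setNorm.enorm.pow_const _) hfin.ne] with x hx
    simpa [ENNReal.rpow_lt_top_iff_of_pos hq0] using hx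

theorem ae_setNorm_lt_top_of_normWeakLK_lt_top {r : ℝ} (hr : 0 < r) (h : normWeakLK r F < ∞) :
    ∀ᵐ x, setNorm (F x) < ∞ := by
  rw [ae_iff]
  by_contra hne
  have hc : volume {x | ¬setNorm (F x) < ∞} ^ (1 / r) ≠ 0 :=
    fun h0 => hne ((ENNReal.rpow_eq_zero_iff_of_pos (by positivity)).1 h0)
  -- If |F| = ∞ on a set of positive measure, that set lies in every superlevel set, and heights k →
  -- ∞ force an infinite weak norm.
  obtain ⟨k, hk⟩ := ENNReal.exists_nat_mul_gt hc h.ne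
  have hk0 : 0 < (k : ℝ≥0) := by
    rcases Nat.eq_zero_or_pos k with rfl | h0
    · simp at hk
    · exact_mod_cast h0
  refine hk.not_ge (le_trans ?_ (le_iSup₂_of_le (f := fun (t : ℝ≥0) (_ : 0 < t) => (t : ℝ≥0∞) *
    volume {x | (t : ℝ≥0∞) < setNorm (F x)} ^ (1 / r)) (k : ℝ≥0) hk0 le_rfl))
  rw [ENNReal.coe_natCast]
  gcongr with x
  intro hx
  rw [not_lt, top_le_iff] at hx
  rw [hx]
  exact ENNReal.natCast_lt_top k

theorem normLK_eq_lintegral {f : EuclideanSpace ℝ (Fin n) → ℝ≥0∞}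
    (hfF : (fun x => setNorm (F x)) =ᵐ[volume] f) {p : ℝ≥0∞} (hp0 : p ≠ 0) (hp : p ≠ ∞) :
    normLK p F = (∫⁻ x, f x ^ p.toReal) ^ (1 / p.toReal) := by
  rw [normLK, eLpNorm_congr_ae hfF, eLpNorm_eq_lintegral_rpow_enorm_toReal hp0 hp]
  simp only [enorm_eq_self]

/-- Strong type of the fractional maximal operator for a finite target exponent. -/
theorem exists_normLK_fractionalMaximal_le (n d : ℕ) {α : ℝ} (hα : 0 < α) {p q : ℝ≥0∞}
    (hp : 1 < p) (hpq : p < q) (hq : q ≠ ∞) (h : 1 / p.toReal - 1 / q.toReal = α) :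
    ∃ C : ℝ≥0∞, C ≠ ∞ ∧ ∀ F : EuclideanSpace ℝ (Fin n) → Set (EuclideanSpace ℝ (Fin d)),
      MemLK p F → normLK q (fractionalMaximal α F) ≤ C * normLK p F := by
  have hp_top : p ≠ ∞ := hpq.ne_top
  have hp0 : p ≠ 0 := (zero_lt_one.trans hp).ne'
  have hq0 : q ≠ 0 := (pos_of_gt hpq).ne'
  have hp1 : 1 < p.toReal := by
    rw [← ENNReal.toReal_one]
    exact (ENNReal.toReal_lt_toReal ENNReal.one_ne_top hp_top).2 hp
  have hq_pos : 0 < q.toReal := ENNReal.toReal_pos hq0 hq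
  obtain ⟨C, hC, hM⟩ := exists_lintegral_maximalFunction_rpow_le
    (volume : Measure (EuclideanSpace ℝ (Fin n))) hp1
  set P := p.toReal
  set R := q.toReal
  have hs : (1 - P * α) * R = P := by
    rw [← h]
    field_simp
    ring
  have hs0 : 0 ≤ 1 - P * α := by
    by_contra! hneg
    have := mul_neg_of_neg_of_pos hneg hq_pos
    linarith
  refine ⟨ballCubeRatio n ^ (1 - P * α) * C ^ (1 / R),
    ENNReal.mul_ne_top (ENNReal.rpow_ne_top_of_nonneg hs0 ballCubeRatio_ne_top)
      (ENNReal.rpow_ne_top_of_nonneg (by positivity) hC), fun F hF => ?_⟩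
  obtain ⟨f, hf, hfF⟩ := hF.measurable.aemeasurable_setNorm
  rw [normLK_eq_lintegral hfF hp0 hp_top,
    normLK_eq_lintegral (F := fractionalMaximal α F) Filter.EventuallyEq.rfl hq0 hq]
  set J := ∫⁻ x, f x ^ P
  calc (∫⁻ x, setNorm (fractionalMaximal α F x) ^ R) ^ (1 / R)
      ≤ (∫⁻ x, (ballCubeRatio n ^ (1 - P * α) * J ^ α) ^ R *
          maximalFunction volume f x ^ P) ^ (1 / R) := by
        gcongr with x
        calc setNorm (fractionalMaximal α F x) ^ R
            ≤ (ballCubeRatio n ^ (1 - P * α) * maximalFunction volume f x ^ (1 - P * α) *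
                J ^ α) ^ R := by
              gcongr
              exact setNorm_fractionalMaximal_le_maximalFunction hf hfF hp1.le hα.le
                (by linarith) x
          _ = ((ballCubeRatio n ^ (1 - P * α) * J ^ α) *
                maximalFunction volume f x ^ (1 - P * α)) ^ R := by ring_nf
          _ = _ := by rw [ENNReal.mul_rpow_of_nonneg _ _ hq_pos.le, ← ENNReal.rpow_mul, hs]
    _ ≤ ((ballCubeRatio n ^ (1 - P * α) * J ^ α) ^ R * (C * J)) ^ (1 / R) := by
        rw [lintegral_const_mul _ ((measurable_maximalFunction _ _).pow_const _)]
        gcongr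
        exact hM f hf
    _ = ballCubeRatio n ^ (1 - P * α) * C ^ (1 / R) * J ^ (1 / P) := by
        have hR : 0 ≤ 1 / R := by positivity
        -- The scaling relation 1/p = α + 1/q recombines the two powers of J.
        have e : J ^ (1 / P) = J ^ α * J ^ (1 / R) := by
          rw [← ENNReal.rpow_add_of_nonneg _ _ hα.le hR, ← h, sub_add_cancel]
        rw [ENNReal.mul_rpow_of_nonneg _ _ hR, ENNReal.mul_rpow_of_nonneg _ _ hR,
          ← ENNReal.rpow_mul, mul_one_div_cancel hq_pos.ne', ENNReal.rpow_one, e]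
        ring

/-- The endpoint `q = ∞` of the strong type estimate. -/
theorem normLK_top_fractionalMaximal_le {α : ℝ} (hα : 0 < α) {p : ℝ≥0∞}
    (hp : 1 < p) (hp_top : p ≠ ∞) (h : 1 / p.toReal = α) (hF : MemLK p F) :
    normLK ∞ (fractionalMaximal α F) ≤ normLK p F := by
  have hp1 : 1 < p.toReal := by
    rw [← ENNReal.toReal_one]
    exact (ENNReal.toReal_lt_toReal ENNReal.one_ne_top hp_top).2 hp
  have hpα : p.toReal * α = 1 := by
    rw [← h]
    field_simp
  obtain ⟨f, hf, hfF⟩ := hF.measurable.aemeasurable_setNorm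
  rw [normLK_eq_lintegral hfF (zero_lt_one.trans hp).ne' hp_top, normLK, eLpNorm_exponent_top, h]
  refine essSup_le_of_ae_le _ (Filter.Eventually.of_forall fun x => ?_)
  simpa [hpα] using
    setNorm_fractionalMaximal_le_maximalFunction hf hfF hp1.le hα.le hpα.le x

/-- Weak type endpoint estimate for the fractional maximal operator. -/
theorem normWeakLK_fractionalMaximal_le {α : ℝ} (hα0 : 0 < α) (hα1 : α < 1) (hF : MemLK 1 F) :
    normWeakLK (1 / (1 - α)) (fractionalMaximal α F) ≤
      ballCubeRatio n ^ (1 - α) * (4 ^ n) ^ (1 - α) * normLK 1 F := by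
  obtain ⟨f, hf, hfF⟩ := hF.measurable.aemeasurable_setNorm
  have hJ : normLK 1 F = ∫⁻ x, f x := by
    rw [normLK_eq_lintegral hfF one_ne_zero ENNReal.one_ne_top]
    simp
  have hJ_top : ∫⁻ x, f x ≠ ∞ := hJ ▸ hF.norm_lt_top.ne
  rw [hJ]
  set J := ∫⁻ x, f x
  have hs : 0 < 1 - α := by linarith
  set A := ballCubeRatio n ^ (1 - α) * J ^ α with hA
  have hA_top : A ≠ ∞ := ENNReal.mul_ne_top
    (ENNReal.rpow_ne_top_of_nonneg hs.le ballCubeRatio_ne_top)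
    (ENNReal.rpow_ne_top_of_nonneg hα0.le hJ_top)
  have hpt : ∀ x, setNorm (fractionalMaximal α F x) ≤
      A * maximalFunction volume f x ^ (1 - α) := by
    intro x
    have := setNorm_fractionalMaximal_le_maximalFunction hf hfF le_rfl hα0.le
      (by linarith : 1 * α ≤ 1) x
    simp only [one_mul, ENNReal.rpow_one] at this
    refine this.trans_eq ?_
    rw [hA]
    ring
  refine iSup₂_le fun t ht => ?_
  rw [one_div_one_div]
  -- The level l below divides by A, so A = 0, where M_α F has norm 0 everywhere, is treated first.
  rcases eq_or_ne A 0 with hA0 | hA0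
  · have hempty : {x | (t : ℝ≥0∞) < setNorm (fractionalMaximal α F x)} = ∅ := by
      refine eq_empty_of_forall_notMem fun x hx => ?_
      have h0 := hpt x
      rw [hA0, zero_mul] at h0
      exact not_lt_bot ((show (t : ℝ≥0∞) < _ from hx).trans_le h0)
    rw [hempty, measure_empty, ENNReal.zero_rpow_of_pos hs, mul_zero]
    exact zero_le
  -- This l solves A l^(1-α) = t, so |M_α F| > t forces Mf > l.
  · set l := ((t : ℝ≥0∞) / A) ^ (1 / (1 - α)) with hl
    have hl' : A * l ^ (1 - α) = t := by
      rw [hl, ← ENNReal.rpow_mul, one_div_mul_cancel hs.ne', ENNReal.rpow_one,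
        ENNReal.mul_div_cancel hA0 hA_top]
    have hsub : {x | (t : ℝ≥0∞) < setNorm (fractionalMaximal α F x)} ⊆
        {x | l < maximalFunction volume f x} := by
      intro x hx
      by_contra hx'
      rw [mem_ofPred_eq, not_lt] at hx'
      refine (show (t : ℝ≥0∞) < _ from hx).not_ge ((hpt x).trans ?_)
      rw [← hl']
      gcongr
    have hw := mul_measure_lt_maximalFunction_le volume f l
    rw [finrank_euclideanSpace, Fintype.card_fin] at hw
    calc (t : ℝ≥0∞) * volume {x | (t : ℝ≥0∞) < setNorm (fractionalMaximal α F x)} ^ (1 - α)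
        ≤ t * volume {x | l < maximalFunction volume f x} ^ (1 - α) := by gcongr
      _ = A * (l * volume {x | l < maximalFunction volume f x}) ^ (1 - α) := by
          rw [ENNReal.mul_rpow_of_nonneg _ _ hs.le, ← mul_assoc, hl']
      _ ≤ A * (4 ^ n * J) ^ (1 - α) := by gcongr
      _ = ballCubeRatio n ^ (1 - α) * (4 ^ n) ^ (1 - α) * (J ^ α * J ^ (1 - α)) := by
          rw [ENNReal.mul_rpow_of_nonneg _ _ hs.le, hA]
          ring
      _ = _ := by
          rw [← ENNReal.rpow_add_of_nonneg _ _ hα0.le hs.le, add_sub_cancel, ENNReal.rpow_one]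

theorem memLK_fractionalMaximal {α : ℝ} {q : ℝ≥0∞} (hq : q ≠ 0) (hF : ∀ᵐ x, IsKbcs (F x))
    (h : normLK q (fractionalMaximal α F) < ∞) : MemLK q (fractionalMaximal α F) where
  measurable := setMeasurable_fractionalMaximal hF
  values := by
    filter_upwards [ae_setNorm_lt_top_of_normLK_lt_top hq (setMeasurable_fractionalMaximal hF) h]
      with x hx using isKbcs_fractionalMaximal hF hx
  norm_lt_top := h

theorem memWeakLK_fractionalMaximal {α r : ℝ} (hr : 0 < r) (hF : ∀ᵐ x, IsKbcs (F x))
    (h : normWeakLK r (fractionalMaximal α F) < ∞) : MemWeakLK r (fractionalMaximal α F) where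
  measurable := setMeasurable_fractionalMaximal hF
  values := by
    filter_upwards [ae_setNorm_lt_top_of_normWeakLK_lt_top hr h]
      with x hx using isKbcs_fractionalMaximal hF hx
  norm_lt_top := h

end ConvexSetValued

theorem theorem3p3 (n d : ℕ) (α : ℝ) (hα0 : 0 < α) (hα1 : α < 1) :
    (∀ p q : ℝ≥0∞, 1 < p → p < q → 1 / p - 1 / q = ENNReal.ofReal α →
      ∃ C : ℝ≥0, ∀ F : EuclideanSpace ℝ (Fin n) → Set (EuclideanSpace ℝ (Fin d)),
        MemLK p F →
          LocallyIntegrablyBounded F ∧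
          MemLK q (fractionalMaximal α F) ∧
          normLK q (fractionalMaximal α F) ≤ C * normLK p F) ∧
    (∃ C : ℝ≥0, ∀ F : EuclideanSpace ℝ (Fin n) → Set (EuclideanSpace ℝ (Fin d)),
      MemLK 1 F →
        LocallyIntegrablyBounded F ∧
        MemWeakLK (1 / (1 - α)) (fractionalMaximal α F) ∧
        normWeakLK (1 / (1 - α)) (fractionalMaximal α F) ≤ C * normLK 1 F) := by
  refine ⟨fun p q hp hpq h => ?_, ?_⟩
  · have hp_top : p ≠ ∞ := hpq.ne_top
    have hq0 : q ≠ 0 := (pos_of_gt hpq).ne'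
    have hreal : 1 / p.toReal - 1 / q.toReal = α := by
      have h' := congrArg ENNReal.toReal h
      rw [ENNReal.toReal_ofReal hα0.le, ENNReal.toReal_sub_of_le
        (ENNReal.div_le_div_left hpq.le 1) (by simp [(zero_lt_one.trans hp).ne'])] at h'
      simpa using h'
    obtain ⟨C, hC, hbound⟩ : ∃ C : ℝ≥0∞, C ≠ ∞ ∧
        ∀ F : EuclideanSpace ℝ (Fin n) → Set (EuclideanSpace ℝ (Fin d)),
        MemLK p F → normLK q (fractionalMaximal α F) ≤ C * normLK p F := by
      rcases eq_or_ne q ∞ with rfl | hq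
      · refine ⟨1, ENNReal.one_ne_top, fun F hF => ?_⟩
        rw [one_mul]
        exact normLK_top_fractionalMaximal_le hα0 hp hp_top (by simpa using hreal) hF
      · exact exists_normLK_fractionalMaximal_le n d hα0 hp hpq hq hreal
    lift C to ℝ≥0 using hC
    refine ⟨C, fun F hF => ⟨hF.locallyIntegrablyBounded hp.le, ?_, hbound F hF⟩⟩
    exact memLK_fractionalMaximal hq0 hF.values
      ((hbound F hF).trans_lt (ENNReal.mul_lt_top ENNReal.coe_lt_top hF.norm_lt_top))
  · have hs : 0 < 1 - α := by linarith
    obtain ⟨C, hC⟩ : ∃ C : ℝ≥0, (C : ℝ≥0∞) = ballCubeRatio n ^ (1 - α) * (4 ^ n) ^ (1 - α) :=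
      ⟨_, ENNReal.coe_toNNReal (ENNReal.mul_ne_top
        (ENNReal.rpow_ne_top_of_nonneg hs.le ballCubeRatio_ne_top)
        (ENNReal.rpow_ne_top_of_nonneg hs.le (by simp)))⟩
    refine ⟨C, fun F hF => ?_⟩
    have hbound := normWeakLK_fractionalMaximal_le hα0 hα1 hF
    rw [← hC] at hbound
    refine ⟨hF.locallyIntegrablyBounded le_rfl, ?_, hbound⟩
    exact memWeakLK_fractionalMaximal (by positivity) hF.values
      (hbound.trans_lt (ENNReal.mul_lt_top ENNReal.coe_lt_top hF.norm_lt_top))
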